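/- All rings are commutative; a local ring is a Noetherian ring with exactly one maximal ideal, and $\widehat{B}$ denotes the completion of a local ring $B$ at its maximal ideal. If $A$ is a ring containing $\mathbb{Q}$ and $\mathfrak{a}$ is an ideal of $\mathbb{Q}[[y_1,\ldots,y_n]]$, then $\mathfrak{a}A[[y_1,\ldots,y_n]]$ is the ideal of $A[[y_1,\ldots,y_n]]$ generated by $\mathfrak{a}$; if $J$ is an ideal of $A$, then $J^e = JA[[y_1,\ldots,y_n]]$. Let $I$ be a proper ideal of $\mathbb{Q}[[y_1,\ldots,y_n]]$ and let $\{\mathfrak{q}_1,\ldots,\mathfrak{q}_k\}$ be the set of minimal prime ideals over $I$ in $\mathbb{Q}[[y_1,\ldots,y_n]]$. Assume that for every domain $D$ containing $\mathbb{Q}$ and all $i,j\in\{1,\ldots,k\}$, the ideal $\mathfrak{q}_iD[[y_1,\ldots,y_n]]$ is a prime ideal of $D[[y_1,\ldots,y_n]]$, and $\mathfrak{q}_iD[[y_1,\ldots,y_n]]\subseteq\mathfrak{q}_jD[[y_1,\ldots,y_n]]$ if and only if $i=j$. Let $(T,M)$ be a local ring containing $\mathbb{Q}$ and let $Q_1,Q_2$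 be prime ideals of $T$ with $Q_1\not\subseteq Q_2$ and $Q_2\not\subseteq Q_1$. Let $\overline{T}=T/(Q_1\cap Q_2)$, and for an ideal $J\supseteq Q_1\cap Q_2$ of $T$ write $\overline{J}=J/(Q_1\cap Q_2)$. Let $R$ be a subring of $\overline{T}$ that contains $\mathbb{Q}$, is a domain, and is a local ring with maximal ideal $R\cap\overline{M}$, such that $\widehat{R}\cong\widehat{\overline{T}}$ as rings. Then the minimal prime ideals over $I\,\overline{T}[[y_1,\ldots,y_n]]$ in $\overline{T}[[y_1,\ldots,y_n]]$ are exactly the ideals $$\overline{Q}_i^{\,e}+\mathfrak{q}_j\overline{T}[[y_1,\ldots,y_n]],\qquad i\in\{1,2\},\ j\in\{1,\ldots,k\},$$ and these $2k$ ideals are pairwise distinct. The minimal prime ideals over $I\,R[[y_1,\ldots,y_n]]$ in $R[[y_1,\ldots,y_n]]$ are exactly the ideals $\mathfrak{q}_jR[[y_1,\ldots,y_n]]$, $j\in\{1,\ldots,k\}$, and these $k$ ideals are pairwise distinct. -/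

import Mathlib

universe u

/-- The ideal `𝔞 A[[y₁, …, yₙ]]` generated in `A[[y₁, …, yₙ]]` by (the image of) an ideal `𝔞` of
`ℚ[[y₁, …, yₙ]]`, where `A` is a commutative ring containing the rationals. -/
noncomputable def extendCoeff {n : ℕ} (A : Type*) [CommRing A] [Algebra ℚ A]
    (𝔞 : Ideal (MvPowerSeries (Fin n) ℚ)) : Ideal (MvPowerSeries (Fin n) A) :=
  𝔞.map (MvPowerSeries.map (σ := Fin n) (algebraMap ℚ A))

/-- The ideal `J^e = J A[[y₁, …, yₙ]]` generated in `A[[y₁, …, yₙ]]` by (the constant power series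
given by) the elements of an ideal `J` of `A`. -/
noncomputable def extendIdeal (n : ℕ) {A : Type*} [CommRing A] (J : Ideal A) :
    Ideal (MvPowerSeries (Fin n) A) :=
  J.map (MvPowerSeries.C (σ := Fin n) (R := A))

/-- For ideals `N` and `J` of `T`, the image `J̄ = (J + N) / N` of `J` in `T ⧸ N`;
this is `J / N` when `N ⊆ J`. -/
def barIdeal {T : Type*} [CommRing T] (N J : Ideal T) : Ideal (T ⧸ N) :=
  J.map (Ideal.Quotient.mk N)

/-! For a prime `J` of the Noetherian ring `T̄`, the ideal `J^e + 𝔮ⱼT̄[[y]]` is the preimage of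
`𝔮ⱼD[[y]]` with `D = T̄/J` a domain (`comap_extendCoeff_quotient`). So the assumption on domains
makes these ideals prime, and incomparable for fixed `J`. Constant terms recover `J`
(`comap_C_sup_le`), which separates `Q̄₁` from `Q̄₂`. Conversely, a prime over `I T̄[[y]]` contracts
in `ℚ[[y]]` to a prime over some `𝔮ⱼ`, and in `T̄` to a prime over `Q̄₁` or `Q̄₂`. Over the domain
`R` the assumption applies directly. -/

open MvPowerSeries in
/-- For a finitely generated ideal `J` of `A`, the kernel of `A[[y]] → (A ⧸ J)[[y]]` is
`J A[[y]]`. -/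
theorem ker_map_mk_eq_extendIdeal (n : ℕ) {A : Type*} [CommRing A] {J : Ideal A} (hJ : J.FG) :
    RingHom.ker (MvPowerSeries.map (σ := Fin n) (Ideal.Quotient.mk J)) = extendIdeal n J := by
  apply le_antisymm
  · intro f hf
    obtain ⟨m, a, rfl⟩ := Submodule.fg_iff_exists_fin_generating_family.mp hJ
    have hc : ∀ d, ∃ c : Fin m → A, ∑ i, c i * a i = coeff d f := by
      intro d
      have h : coeff d f ∈ Ideal.span (Set.range a) := by
        rw [← Ideal.Quotient.eq_zero_iff_mem]
        have := congrArg (coeff d) ((RingHom.mem_ker).1 hf)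
        simpa using this
      exact (Ideal.mem_span_range_iff_exists_fun).1 h
    choose c hc using hc
    -- Finite generation is what matters: the same `m` generators serve all coefficients, so the
    -- chosen multipliers assemble into `m` power series.
    let g : Fin m → MvPowerSeries (Fin n) A := fun i d => c d i
    have hfe : f = ∑ i, g i * C (a i) := by
      ext d
      rw [map_sum, ← hc d]
      refine Finset.sum_congr rfl fun i _ => ?_
      rw [coeff_mul_C]
      rfl
    rw [hfe]
    exact Ideal.sum_mem _ fun i _ => Ideal.mul_mem_left _ _
      (Ideal.mem_map_of_mem _ (Ideal.subset_span ⟨i, rfl⟩))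
  · rw [extendIdeal, Ideal.map_le_iff_le_comap]
    intro a ha
    rw [Ideal.mem_comap, RingHom.mem_ker, map_C, Ideal.Quotient.eq_zero_iff_mem.2 ha, map_zero]

theorem map_extendCoeff {n : ℕ} {A B : Type*} [CommRing A] [CommRing B] [Algebra ℚ A]
    [Algebra ℚ B] (φ : A →+* B) (𝔞 : Ideal (MvPowerSeries (Fin n) ℚ)) :
    (extendCoeff A 𝔞).map (MvPowerSeries.map (σ := Fin n) φ) = extendCoeff B 𝔞 := by
  rw [extendCoeff, extendCoeff, Ideal.map_map, ← MvPowerSeries.map_comp]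
  congr 2
  -- A ring has at most one ring homomorphism from `ℚ`.
  exact Subsingleton.elim _ _

theorem extendCoeff_mono {n : ℕ} (A : Type*) [CommRing A] [Algebra ℚ A]
    {𝔞 𝔟 : Ideal (MvPowerSeries (Fin n) ℚ)} (h : 𝔞 ≤ 𝔟) : extendCoeff A 𝔞 ≤ extendCoeff A 𝔟 :=
  Ideal.map_mono h

theorem map_surjective_of_surjective {σ A B : Type*} [CommRing A] [CommRing B] {φ : A →+* B}
    (hφ : Function.Surjective φ) : Function.Surjective (MvPowerSeries.map (σ := σ) φ) := by
  intro g
  choose s hs using hφ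
  exact ⟨fun d => s (g d), by ext d; exact hs _⟩

/-- `J^e + 𝔞 A[[y]]` is the preimage of `𝔞 (A ⧸ J)[[y]]`. -/
theorem comap_extendCoeff_quotient {n : ℕ} {A : Type*} [CommRing A] [Algebra ℚ A] {J : Ideal A}
    (hJ : J.FG) (𝔞 : Ideal (MvPowerSeries (Fin n) ℚ)) :
    (extendCoeff (A ⧸ J) 𝔞).comap (MvPowerSeries.map (σ := Fin n) (Ideal.Quotient.mk J)) =
      extendIdeal n J ⊔ extendCoeff A 𝔞 := by
  rw [← map_extendCoeff (Ideal.Quotient.mk J), Ideal.comap_map_of_surjective _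
    (map_surjective_of_surjective Ideal.Quotient.mk_surjective), ← RingHom.ker_eq_comap_bot,
    ker_map_mk_eq_extendIdeal n hJ, sup_comm]

/-- The elements of `𝔞 A[[y]]` have vanishing constant coefficient if `𝔞` is proper. -/
theorem extendCoeff_le_ker_constantCoeff {n : ℕ} (A : Type*) [CommRing A] [Algebra ℚ A]
    {𝔞 : Ideal (MvPowerSeries (Fin n) ℚ)} (h𝔞 : 𝔞 ≠ ⊤) :
    extendCoeff A 𝔞 ≤ RingHom.ker (MvPowerSeries.constantCoeff (σ := Fin n) (R := A)) := by
  rw [extendCoeff, Ideal.map_le_iff_le_comap]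
  intro f hf
  have h0 : MvPowerSeries.constantCoeff f = 0 := by
    by_contra h
    exact h𝔞 (Ideal.eq_top_of_isUnit_mem _ hf
      (MvPowerSeries.isUnit_iff_constantCoeff.2 (isUnit_iff_ne_zero.2 h)))
  rw [Ideal.mem_comap, RingHom.mem_ker, MvPowerSeries.constantCoeff_map, h0, map_zero]

/-- Every element of the sum has constant term in `J`, since a proper `𝔞` contributes only zero
constant terms. -/
theorem comap_C_sup_le {n : ℕ} {A : Type*} [CommRing A] [Algebra ℚ A] (J : Ideal A)
    {𝔞 : Ideal (MvPowerSeries (Fin n) ℚ)} (h𝔞 : 𝔞 ≠ ⊤) :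
    (extendIdeal n J ⊔ extendCoeff A 𝔞).comap (MvPowerSeries.C (σ := Fin n) (R := A)) ≤ J := by
  have h : extendIdeal n J ⊔ extendCoeff A 𝔞 ≤ J.comap MvPowerSeries.constantCoeff := by
    refine sup_le ?_ ((extendCoeff_le_ker_constantCoeff A h𝔞).trans (Ideal.comap_mono bot_le))
    rw [extendIdeal, Ideal.map_le_iff_le_comap]
    intro a ha
    simpa using ha
  intro a ha
  simpa using h ha

/-- A prime over `𝔞 A[[y]]` contains the extension of a minimal prime over `𝔞`. -/
theorem exists_minimalPrimes_extendCoeff_le {n : ℕ} {A : Type*} [CommRing A] [Algebra ℚ A]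
    {𝔞 : Ideal (MvPowerSeries (Fin n) ℚ)} {P : Ideal (MvPowerSeries (Fin n) A)} [P.IsPrime]
    (h : extendCoeff A 𝔞 ≤ P) : ∃ 𝔭 ∈ 𝔞.minimalPrimes, extendCoeff A 𝔭 ≤ P := by
  obtain ⟨𝔭, h𝔭, hle⟩ := Ideal.exists_minimalPrimes_le (Ideal.map_le_iff_le_comap.1 h)
  exact ⟨𝔭, h𝔭, Ideal.map_le_iff_le_comap.2 hle⟩

/-- An antichain of primes over `K` such that each prime over `K` contains one of its members is
the family of minimal primes over `K`. -/
theorem minimalPrimes_eq_range {S ι : Type*} [CommRing S] {K : Ideal S} {p : ι → Ideal S}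
    (hp : ∀ i, (p i).IsPrime) (hK : ∀ i, K ≤ p i) (hanti : ∀ i j, p i ≤ p j → i = j)
    (hcov : ∀ P : Ideal S, P.IsPrime → K ≤ P → ∃ i, p i ≤ P) :
    K.minimalPrimes = Set.range p := by
  ext P
  constructor
  · intro hP
    obtain ⟨i, hi⟩ := hcov P hP.1.1 hP.1.2
    exact ⟨i, le_antisymm hi (hP.2 ⟨hp i, hK i⟩ hi)⟩
  · rintro ⟨i, rfl⟩
    refine ⟨⟨hp i, hK i⟩, fun P hP hle => ?_⟩
    obtain ⟨j, hj⟩ := hcov P hP.1 hP.2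
    obtain rfl := hanti j i (hj.trans hle)
    exact hj

theorem comap_barIdeal {T : Type*} [CommRing T] {N Q : Ideal T} (hQ : N ≤ Q) :
    (barIdeal N Q).comap (Ideal.Quotient.mk N) = Q := by
  rw [barIdeal, Ideal.comap_map_of_surjective _ Ideal.Quotient.mk_surjective,
    ← RingHom.ker_eq_comap_bot, Ideal.mk_ker, sup_eq_left.2 hQ]

theorem le_of_barIdeal_le {T : Type*} [CommRing T] {N Q Q' : Ideal T} (hQ : N ≤ Q) (hQ' : N ≤ Q')
    (h : barIdeal N Q ≤ barIdeal N Q') : Q ≤ Q' := by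
  rw [← comap_barIdeal hQ, ← comap_barIdeal hQ']
  exact Ideal.comap_mono h

theorem isPrime_barIdeal {T : Type*} [CommRing T] {N Q : Ideal T} [Q.IsPrime] (hQ : N ≤ Q) :
    (barIdeal N Q).IsPrime :=
  Ideal.map_isPrime_of_surjective Ideal.Quotient.mk_surjective (by rwa [Ideal.mk_ker])

theorem lemma3p1 (n k : ℕ)
    -- a proper ideal `I` of `ℚ[[y₁, …, yₙ]]` and its minimal primes `𝔮₁, …, 𝔮ₖ`
    (I : Ideal (MvPowerSeries (Fin n) ℚ)) (hI : I ≠ ⊤)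
    (q : Fin k → Ideal (MvPowerSeries (Fin n) ℚ))
    (hq : Set.range q = I.minimalPrimes)
    -- the assumption on all domains `D` containing the rationals
    (hD : ∀ (D : Type u) [CommRing D] [IsDomain D] [Algebra ℚ D],
      (∀ i, (extendCoeff D (q i)).IsPrime) ∧
      ∀ i j, extendCoeff D (q i) ≤ extendCoeff D (q j) ↔ i = j)
    -- a local (Noetherian) ring containing the rationals, and two incomparable primes
    (T : Type u) [CommRing T] [IsLocalRing T] [IsNoetherianRing T] [Algebra ℚ T]
    (Q₁ Q₂ : Ideal T) [Q₁.IsPrime] [Q₂.IsPrime] (h₁₂ : ¬ Q₁ ≤ Q₂) (h₂₁ : ¬ Q₂ ≤ Q₁)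
    -- a local (Noetherian) domain `R ⊆ T̄ = T / (Q₁ ∩ Q₂)` containing the rationals,
    -- with maximal ideal `R ∩ M̄` and with completion isomorphic to that of `T̄`
    (R : Subalgebra ℚ (T ⧸ (Q₁ ⊓ Q₂))) [IsDomain R] [IsLocalRing R] [IsNoetherianRing R]
    (hRM : IsLocalRing.maximalIdeal R =
      (barIdeal (Q₁ ⊓ Q₂) (IsLocalRing.maximalIdeal T)).comap R.val)
    (hR : Nonempty (AdicCompletion (IsLocalRing.maximalIdeal R) R ≃+*
      AdicCompletion (barIdeal (Q₁ ⊓ Q₂) (IsLocalRing.maximalIdeal T)) (T ⧸ (Q₁ ⊓ Q₂)))) :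
    -- the minimal primes over `I T̄[[y]]` are the listed ideals, which are `2k` distinct ones
    (extendCoeff (T ⧸ (Q₁ ⊓ Q₂)) I).minimalPrimes =
        Set.range (fun j : Fin k =>
          extendIdeal n (barIdeal (Q₁ ⊓ Q₂) Q₁) ⊔ extendCoeff (T ⧸ (Q₁ ⊓ Q₂)) (q j)) ∪
        Set.range (fun j : Fin k =>
          extendIdeal n (barIdeal (Q₁ ⊓ Q₂) Q₂) ⊔ extendCoeff (T ⧸ (Q₁ ⊓ Q₂)) (q j)) ∧
      Function.Injective (Sum.elim
        (fun j : Fin k =>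
          extendIdeal n (barIdeal (Q₁ ⊓ Q₂) Q₁) ⊔ extendCoeff (T ⧸ (Q₁ ⊓ Q₂)) (q j))
        (fun j : Fin k =>
          extendIdeal n (barIdeal (Q₁ ⊓ Q₂) Q₂) ⊔ extendCoeff (T ⧸ (Q₁ ⊓ Q₂)) (q j))) ∧
      -- the minimal primes over `I R[[y]]` are the listed ideals, which are `k` distinct ones
      (extendCoeff R I).minimalPrimes = Set.range (fun j : Fin k => extendCoeff R (q j)) ∧
      Function.Injective (fun j : Fin k => extendCoeff R (q j)) := by
  have hqmin : ∀ j, q j ∈ I.minimalPrimes := fun j => hq ▸ Set.mem_range_self j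
  have hqtop : ∀ j, q j ≠ ⊤ := fun j => (hqmin j).1.1.ne_top
  have hIq : ∀ j, I ≤ q j := fun j => (hqmin j).1.2
  have hcov : ∀ (A : Type u) [CommRing A] [Algebra ℚ A] (P : Ideal (MvPowerSeries (Fin n) A)),
      P.IsPrime → extendCoeff A I ≤ P → ∃ j, extendCoeff A (q j) ≤ P := by
    intro A _ _ P hP hle
    obtain ⟨𝔭, h𝔭, h⟩ := exists_minimalPrimes_extendCoeff_le hle
    obtain ⟨j, rfl⟩ := hq.symm ▸ h𝔭
    exact ⟨j, h⟩
  have hprime : ∀ J : Ideal (T ⧸ Q₁ ⊓ Q₂), J.IsPrime → ∀ j,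
      (extendIdeal n J ⊔ extendCoeff (T ⧸ Q₁ ⊓ Q₂) (q j)).IsPrime := by
    intro J hJ j
    rw [← comap_extendCoeff_quotient (IsNoetherian.noetherian J)]
    have := (hD ((T ⧸ Q₁ ⊓ Q₂) ⧸ J)).1 j
    exact Ideal.comap_isPrime _ _
  have hsame : ∀ J : Ideal (T ⧸ Q₁ ⊓ Q₂), J.IsPrime → ∀ i j,
      extendIdeal n J ⊔ extendCoeff (T ⧸ Q₁ ⊓ Q₂) (q i) ≤
        extendIdeal n J ⊔ extendCoeff (T ⧸ Q₁ ⊓ Q₂) (q j) → i = j := by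
    intro J hJ i j h
    rw [← comap_extendCoeff_quotient (IsNoetherian.noetherian J),
      ← comap_extendCoeff_quotient (IsNoetherian.noetherian J),
      Ideal.comap_le_comap_iff_of_surjective _
        (map_surjective_of_surjective Ideal.Quotient.mk_surjective)] at h
    exact ((hD ((T ⧸ Q₁ ⊓ Q₂) ⧸ J)).2 i j).1 h
  have hdiff : ∀ J J' : Ideal (T ⧸ Q₁ ⊓ Q₂), ∀ i j,
      extendIdeal n J ⊔ extendCoeff (T ⧸ Q₁ ⊓ Q₂) (q i) ≤
        extendIdeal n J' ⊔ extendCoeff (T ⧸ Q₁ ⊓ Q₂) (q j) → J ≤ J' := by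
    intro J J' i j h a ha
    exact comap_C_sup_le J' (hqtop j) (h (Ideal.mem_sup_left (Ideal.mem_map_of_mem _ ha)))
  have hprime₁ := isPrime_barIdeal (Q := Q₁) (N := Q₁ ⊓ Q₂) inf_le_left
  have hprime₂ := isPrime_barIdeal (Q := Q₂) (N := Q₁ ⊓ Q₂) inf_le_right
  have hanti : ∀ x y : Fin k ⊕ Fin k,
      Sum.elim
        (fun j : Fin k => extendIdeal n (barIdeal (Q₁ ⊓ Q₂) Q₁) ⊔ extendCoeff (T ⧸ Q₁ ⊓ Q₂) (q j))
        (fun j : Fin k => extendIdeal n (barIdeal (Q₁ ⊓ Q₂) Q₂) ⊔ extendCoeff (T ⧸ Q₁ ⊓ Q₂) (q j)) x ≤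
      Sum.elim
        (fun j : Fin k => extendIdeal n (barIdeal (Q₁ ⊓ Q₂) Q₁) ⊔ extendCoeff (T ⧸ Q₁ ⊓ Q₂) (q j))
        (fun j : Fin k => extendIdeal n (barIdeal (Q₁ ⊓ Q₂) Q₂) ⊔ extendCoeff (T ⧸ Q₁ ⊓ Q₂) (q j)) y →
      x = y := by
    rintro (i | i) (j | j) h
    · exact congrArg _ (hsame _ hprime₁ i j h)
    · exact absurd (le_of_barIdeal_le inf_le_left inf_le_right (hdiff _ _ i j h)) h₁₂
    · exact absurd (le_of_barIdeal_le inf_le_right inf_le_left (hdiff _ _ i j h)) h₂₁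
    · exact congrArg _ (hsame _ hprime₂ i j h)
  refine ⟨?_, fun x y h => hanti x y h.le, ?_, fun i j h => ((hD R).2 i j).1 h.le⟩
  · rw [← Set.Sum.elim_range]
    refine minimalPrimes_eq_range ?_ ?_ hanti ?_
    · rintro (j | j)
      · exact hprime _ hprime₁ j
      · exact hprime _ hprime₂ j
    · rintro (j | j) <;> exact (extendCoeff_mono _ (hIq j)).trans le_sup_right
    · intro P hP hle
      obtain ⟨j, hj⟩ := hcov _ P hP hle
      -- `Q̄₁Q̄₂ = 0` because `Q₁Q₂ ⊆ Q₁ ∩ Q₂`, so the contraction of `P` to `T̄` contains one of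
      -- the two.
      have hmul : barIdeal (Q₁ ⊓ Q₂) Q₁ * barIdeal (Q₁ ⊓ Q₂) Q₂ ≤ P.comap MvPowerSeries.C := by
        rw [barIdeal, barIdeal, ← Ideal.map_mul]
        refine (Ideal.map_mono Ideal.mul_le_inf).trans ?_
        rw [Ideal.map_quotient_self]
        exact bot_le
      rcases (Ideal.IsPrime.mul_le (Ideal.comap_isPrime _ P)).1 hmul with h | h
      · exact ⟨Sum.inl j, sup_le (Ideal.map_le_iff_le_comap.2 h) hj⟩
      · exact ⟨Sum.inr j, sup_le (Ideal.map_le_iff_le_comap.2 h) hj⟩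
  · exact minimalPrimes_eq_range (hD R).1 (fun j => extendCoeff_mono _ (hIq j))
      (fun i j => ((hD R).2 i j).1) (fun P hP hle => hcov R P hP hle)
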